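/- Consider a network with one transmitter, one receiver and $R$ parallel amplify-and-forward relays. The channel state is $\mathbf h=(f_1,g_1,\dots,f_R,g_R)$ with independent entries $f_r\sim\mathcal{CN}(0,\sigma_{f_r}^2)$ and $g_r\sim\mathcal{CN}(0,\sigma_{g_r}^2)$. The power levels are $P_i=p_iP$, $i=0,\dots,R$, where the $p_i,\sigma_{f_r},\sigma_{g_r}>0$ are fixed and $P>0$ varies. For $\mathbf x\in\mathbb C^R$ put $$\mathrm{SNR}_P(\mathbf x,\mathbf h)=\frac{P_0\left|\sum_{r=1}^R x_rf_rg_r\sqrt{\rho_r}\right|^2}{1+\sum_{r=1}^R|x_r|^2|g_r|^2\rho_r},\qquad \rho_r=\frac{P_r}{1+|f_r|^2P_0}.$$ Let $\mathcal C\subset\mathbb C^R$ be a finite nonempty codebook that does not depend on $P$, with $|x_r|\le 1$ for all $\mathbf x\in\mathcal C$ and all $r$. For each $P>0$ let $\mathcal Q^\star_P(\mathbf h)\in\arg\max_{\mathbf x\in\mathcal C}\mathrm{SNR}_P(\mathbf x,\mathbf h)$ be an optimal quantizer. Its symbol error rate (for binary signaling) is $\mathrm{SER}_P=\mathrm E_{\mathbf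 h}\big[\mathrm Q\big(\sqrt{2\,\mathrm{SNR}_P(\mathcal Q^\star_P(\mathbf h),\mathbf h)}\big)\big]$, where $\mathrm Q$ is the Gaussian tail function. The diversity of $\mathcal C$ is $$\mathsf d(\mathcal C)=\lim_{P\to\infty}-\frac{\log \mathrm{SER}_P}{\log P}.$$ Let $\mathscr R(\mathcal C)$ be the family of all $\mathcal R\subset\{1,\dots,R\}$ such that every $\mathbf x\in\mathcal C$ has an entry $x_r\ne0$ with $r\in\mathcal R$. Then $$\mathsf d(\mathcal C)\le\min\{|\mathcal R|:\mathcal R\in\mathscr R(\mathcal C)\},$$ where the minimum is read as $+\infty$ if $\mathscr R(\mathcal C)$ is empty (that is, if $\mathbf 0\in\mathcal C$). The same bound holds for the upper limit $\limsup_{P\to\infty}\big(-\log\mathrm{SER}_P/\log P\big)$, whether or not the limit exists. -/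

import Mathlib

open MeasureTheory ProbabilityTheory Filter Topology

noncomputable section

/-- The fixed parameters of a network with one transmitter, one receiver and `R` parallel relays:
power scalers `p₀` (transmitter) and `p r` (relay `r`), and the channel standard deviations
`σf r` (transmitter to relay `r`) and `σg r` (relay `r` to receiver). All are positive. -/
structure RelayNetwork (R : ℕ) where
  p₀ : ℝ
  p : Fin R → ℝ
  σf : Fin R → ℝ
  σg : Fin R → ℝ
  p₀_pos : 0 < p₀
  p_pos : ∀ r, 0 < p r
  σf_pos : ∀ r, 0 < σf r
  σg_pos : ∀ r, 0 < σg r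

/-- Beamforming vectors. -/
abbrev BeamVector (R : ℕ) : Type := Fin R → ℂ

/-- A channel state `h = (f, g)`. -/
abbrev ChannelState (R : ℕ) : Type := (Fin R → ℂ) × (Fin R → ℂ)

/-- The law `CN(0, σ²)`: independent real and imaginary parts, each centered Gaussian with
variance `σ² / 2`. -/
def complexGaussian (σ : ℝ) : Measure ℂ :=
  ((gaussianReal 0 (Real.toNNReal (σ ^ 2 / 2))).prod
    (gaussianReal 0 (Real.toNNReal (σ ^ 2 / 2)))).map (fun z : ℝ × ℝ => (⟨z.1, z.2⟩ : ℂ))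

/-- The Gaussian tail function `Q(x)`. -/
def gaussianTail (x : ℝ) : ℝ := (gaussianReal 0 1).real (Set.Ioi x)

namespace RelayNetwork

variable {R : ℕ} (N : RelayNetwork R)

/-- The law of the channel state: all `f r ∼ CN(0, (σf r)²)` and `g r ∼ CN(0, (σg r)²)` are
independent. -/
def channelLaw : Measure (ChannelState R) :=
  (Measure.pi fun r => complexGaussian (N.σf r)).prod
    (Measure.pi fun r => complexGaussian (N.σg r))

/-- The relay normalization factor `ρ_r = P_r / (1 + |f_r|² P₀)`, with `P_r = p_r P` and
`P₀ = p₀ P`. -/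
def rho (P : ℝ) (h : ChannelState R) (r : Fin R) : ℝ :=
  (N.p r * P) / (1 + ‖h.1 r‖ ^ 2 * (N.p₀ * P))

/-- The received signal-to-noise ratio for the beamforming vector `x` in channel state `h`. -/
def SNR (P : ℝ) (x : BeamVector R) (h : ChannelState R) : ℝ :=
  (N.p₀ * P) * ‖∑ r, x r * h.1 r * h.2 r * ((Real.sqrt (N.rho P h r) : ℝ) : ℂ)‖ ^ 2 /
    (1 + ∑ r, ‖x r‖ ^ 2 * ‖h.2 r‖ ^ 2 * N.rho P h r)

/-- The symbol error rate at power level `P` of a quantizer `q`, which maps each channel state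
to a beamforming vector (binary constellation). -/
def SER (P : ℝ) (q : ChannelState R → BeamVector R) : ℝ :=
  ∫ h, gaussianTail (Real.sqrt (2 * N.SNR P (q h) h)) ∂N.channelLaw

/-- `q` is an optimal quantizer for the codebook `C` at power level `P`:
`q h ∈ argmax_{x ∈ C} SNR_P(x, h)` for every channel state `h`. -/
def IsOptimalQuantizer (P : ℝ) (C : Set (BeamVector R))
    (q : ChannelState R → BeamVector R) : Prop :=
  ∀ h, q h ∈ C ∧ ∀ x ∈ C, N.SNR P x h ≤ N.SNR P (q h) h

/-- The quantity `- log SER_P(Q_P) / log P`, whose limit as `P → ∞` is the diversity of the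
collection `Q = (Q_P)` of quantizers. -/
def diversityRatio (Q : ℝ → ChannelState R → BeamVector R) (P : ℝ) : EReal :=
  ((-Real.log (N.SER P (Q P)) / Real.log P : ℝ) : EReal)

/-- The collection `Q = (Q_P)` of quantizers has diversity `d`. The value `⊤` is allowed. -/
def HasDiversity (Q : ℝ → ChannelState R → BeamVector R) (d : EReal) : Prop :=
  Tendsto (N.diversityRatio Q) atTop (𝓝 d)

end RelayNetwork

/-- The sets of relays in which every codeword of `C` has a nonzero entry. -/
def relayCovers {R : ℕ} (C : Set (BeamVector R)) : Set (Finset (Fin R)) :=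
  {S | ∀ x ∈ C, ∃ r ∈ S, x r ≠ 0}

end

/-! Fix a cover `S` and let every relay in `S` have `|f_r|² ≤ 1/P` while all `|g_r|` lie in `[1,
2]`. Each deep fade costs a factor of order `1/P`, so this event has probability at least `c * P⁻¹ ^
S.card` (`exists_le_channelLaw_real_noisyRelays`). On it no codeword does well: the signal power is
`O(P)`, but each codeword uses some relay of `S`, which forwards noise of power at least a constant
times `P`. Hence the SNR is bounded uniformly in `P` (`exists_SNR_le_on_noisyRelays`), and the error
rate is at least a constant times `P⁻¹ ^ S.card`. Logarithms give the exponent. -/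

/-! ### Gaussian lower bounds -/

lemma exists_mul_le_gaussianReal_real_Icc {v : NNReal} (hv : v ≠ 0) :
    ∃ c : ℝ, 0 < c ∧ ∀ a b : ℝ, 0 ≤ a → a ≤ b → b ≤ 2 →
      c * (b - a) ≤ (gaussianReal 0 v).real (Set.Icc a b) := by
  -- The centered density decreases on `[0, 2]`, so its value at `2` is its minimum there.
  have hpos : 0 < gaussianPDFReal 0 v 2 := gaussianPDFReal_pos 0 v 2 hv
  refine ⟨gaussianPDFReal 0 v 2, hpos, fun a b ha hab hb => ?_⟩
  have hle : ENNReal.ofReal (gaussianPDFReal 0 v 2 * (b - a)) ≤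
      gaussianReal 0 v (Set.Icc a b) := by
    rw [gaussianReal_apply 0 hv, ENNReal.ofReal_mul hpos.le, ← Real.volume_Icc,
      ← setLIntegral_const]
    refine setLIntegral_mono (measurable_gaussianPDF 0 v) fun x hx => ?_
    rw [gaussianPDF]
    refine ENNReal.ofReal_le_ofReal ?_
    simp only [gaussianPDFReal, sub_zero]
    have hx0 : 0 ≤ x := ha.trans hx.1
    have hx2 : x ≤ 2 := hx.2.trans hb
    gcongr
  exact (ENNReal.ofReal_le_iff_le_toReal (measure_ne_top _ _)).1 hle

lemma measurable_complex_mk : Measurable fun z : ℝ × ℝ => (⟨z.1, z.2⟩ : ℂ) :=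
  Complex.measurableEquivRealProd.symm.measurable

instance (σ : ℝ) : IsProbabilityMeasure (complexGaussian σ) :=
  Measure.isProbabilityMeasure_map measurable_complex_mk.aemeasurable

lemma exists_mul_sq_le_complexGaussian_real {σ : ℝ} (hσ : 0 < σ) :
    ∃ c : ℝ, 0 < c ∧ ∀ a b : ℝ, 0 ≤ a → a ≤ b → b ≤ 2 → ∀ s : Set ℂ, MeasurableSet s →
      (∀ x ∈ Set.Icc a b, ∀ y ∈ Set.Icc a b, (⟨x, y⟩ : ℂ) ∈ s) →
      c * (b - a) ^ 2 ≤ (complexGaussian σ).real s := by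
  have hv : Real.toNNReal (σ ^ 2 / 2) ≠ 0 := by
    rw [Ne, Real.toNNReal_eq_zero, not_le]
    positivity
  obtain ⟨c, hc, h⟩ := exists_mul_le_gaussianReal_real_Icc hv
  refine ⟨c ^ 2, by positivity, fun a b ha hab hb s hs hbox => ?_⟩
  rw [complexGaussian, map_measureReal_apply measurable_complex_mk hs]
  calc c ^ 2 * (b - a) ^ 2 = (c * (b - a)) * (c * (b - a)) := by ring
    _ ≤ (gaussianReal 0 (Real.toNNReal (σ ^ 2 / 2))).real (Set.Icc a b) *
          (gaussianReal 0 (Real.toNNReal (σ ^ 2 / 2))).real (Set.Icc a b) :=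
        mul_le_mul (h a b ha hab hb) (h a b ha hab hb)
          (mul_nonneg hc.le (sub_nonneg.2 hab)) measureReal_nonneg
    _ = ((gaussianReal 0 (Real.toNNReal (σ ^ 2 / 2))).prod
          (gaussianReal 0 (Real.toNNReal (σ ^ 2 / 2)))).real (Set.Icc a b ×ˢ Set.Icc a b) :=
        (measureReal_prod_prod _ _).symm
    _ ≤ _ := measureReal_mono fun z hz => hbox _ hz.1 _ hz.2

lemma exists_div_le_complexGaussian_real_ball {σ : ℝ} (hσ : 0 < σ) :
    ∃ c : ℝ, 0 < c ∧ ∀ P : ℝ, 1 ≤ P →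
      c * P⁻¹ ≤ (complexGaussian σ).real {z | ‖z‖ ^ 2 * P ≤ 1} := by
  obtain ⟨c, hc, h⟩ := exists_mul_sq_le_complexGaussian_real hσ
  refine ⟨c / 4, by positivity, fun P hP => ?_⟩
  have hP0 : 0 < P := one_pos.trans_le hP
  have hsq : (Real.sqrt P) ^ 2 = P := Real.sq_sqrt hP0.le
  have h1 : 1 ≤ Real.sqrt P := Real.one_le_sqrt.2 hP
  -- A square of side `1 / (2√P)` at the origin fits in the disc of radius `1 / √P`, and its area is
  -- of order `1/P`.
  have hδ : ((Real.sqrt P)⁻¹ / 2) ^ 2 = P⁻¹ / 4 := by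
    rw [div_pow, inv_pow, hsq]; norm_num
  have key := h 0 ((Real.sqrt P)⁻¹ / 2) le_rfl (by positivity)
    (by have := inv_le_one_of_one_le₀ h1; linarith) {z | ‖z‖ ^ 2 * P ≤ 1}
    (measurableSet_le (by fun_prop) (by fun_prop)) (fun x hx y hy => ?_)
  · rw [sub_zero, hδ] at key
    linarith
  · have hx2 : x ^ 2 ≤ P⁻¹ / 4 := hδ ▸ pow_le_pow_left₀ hx.1 hx.2 2
    have hy2 : y ^ 2 ≤ P⁻¹ / 4 := hδ ▸ pow_le_pow_left₀ hy.1 hy.2 2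
    have hn : ‖(⟨x, y⟩ : ℂ)‖ ^ 2 ≤ P⁻¹ := by
      rw [← Complex.normSq_eq_norm_sq, Complex.normSq_mk]
      have : 0 < P⁻¹ := by positivity
      nlinarith
    calc ‖(⟨x, y⟩ : ℂ)‖ ^ 2 * P ≤ P⁻¹ * P := by gcongr
      _ = 1 := inv_mul_cancel₀ hP0.ne'

lemma measurableSet_norm_mem_Icc (a b : ℝ) : MeasurableSet {z : ℂ | a ≤ ‖z‖ ∧ ‖z‖ ≤ b} :=
  measurable_norm measurableSet_Icc

lemma complexGaussian_real_annulus_pos {σ : ℝ} (hσ : 0 < σ) :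
    0 < (complexGaussian σ).real {z | 1 ≤ ‖z‖ ∧ ‖z‖ ≤ 2} := by
  obtain ⟨c, hc, h⟩ := exists_mul_sq_le_complexGaussian_real hσ
  refine lt_of_lt_of_le (by positivity : 0 < c * (5 / 4 - 1) ^ 2)
    (h 1 (5 / 4) (by norm_num) (by norm_num) (by norm_num) _
      (measurableSet_norm_mem_Icc 1 2) fun x hx y hy => ?_)
  have hn : ‖(⟨x, y⟩ : ℂ)‖ ^ 2 = x * x + y * y := by
    rw [← Complex.normSq_eq_norm_sq, Complex.normSq_mk]
  obtain ⟨hx1, hx2⟩ := hx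
  obtain ⟨hy1, hy2⟩ := hy
  exact ⟨(sq_le_sq₀ (by norm_num) (norm_nonneg _)).1 (by rw [hn]; nlinarith),
    (sq_le_sq₀ (norm_nonneg _) (by norm_num)).1 (by rw [hn]; nlinarith)⟩

lemma gaussianTail_pos (x : ℝ) : 0 < gaussianTail x := by
  refine ENNReal.toReal_pos (fun h => ?_) (measure_ne_top _ _)
  -- A half-line null for the Gaussian would be Lebesgue null.
  have := gaussianReal_absolutelyContinuous' 0 one_ne_zero h
  simp at this

lemma gaussianTail_antitone : Antitone gaussianTail := fun _ _ h =>
  measureReal_mono (Set.Ioi_subset_Ioi h)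

lemma gaussianTail_le_one (x : ℝ) : gaussianTail x ≤ 1 := measureReal_le_one

/-! ### Probability of the bad event -/

namespace RelayNetwork

variable {R : ℕ} (N : RelayNetwork R)

instance : IsProbabilityMeasure N.channelLaw := by
  unfold channelLaw; infer_instance

/-- Channel states in which the relays in `S` receive almost nothing but amplify their noise,
while all channels from the relays to the receiver have gain between `1` and `2`. -/
def noisyRelays (P : ℝ) (S : Finset (Fin R)) : Set (ChannelState R) :=
  (Set.univ.pi fun r => if r ∈ S then {z : ℂ | ‖z‖ ^ 2 * P ≤ 1} else Set.univ) ×ˢ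
    (Set.univ.pi fun _ => {z : ℂ | 1 ≤ ‖z‖ ∧ ‖z‖ ≤ 2})

lemma measurableSet_noisyRelays (P : ℝ) (S : Finset (Fin R)) :
    MeasurableSet (noisyRelays P S) := by
  refine (MeasurableSet.univ_pi fun r => ?_).prod (MeasurableSet.univ_pi fun _ => ?_)
  · split_ifs
    · exact measurableSet_le (by fun_prop) (by fun_prop)
    · exact MeasurableSet.univ
  · exact measurableSet_norm_mem_Icc 1 2

lemma exists_le_channelLaw_real_noisyRelays (S : Finset (Fin R)) :
    ∃ c : ℝ, 0 < c ∧ ∀ P : ℝ, 1 ≤ P →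
      c * P⁻¹ ^ S.card ≤ N.channelLaw.real (noisyRelays P S) := by
  choose c hc h using fun r => exists_div_le_complexGaussian_real_ball (N.σf_pos r)
  refine ⟨(∏ r ∈ S, c r) *
    ∏ r, (complexGaussian (N.σg r)).real {z : ℂ | 1 ≤ ‖z‖ ∧ ‖z‖ ≤ 2},
    mul_pos (Finset.prod_pos fun r _ => hc r)
      (Finset.prod_pos fun r _ => complexGaussian_real_annulus_pos (N.σg_pos r)),
    fun P hP => ?_⟩
  have hP0 : 0 < P := one_pos.trans_le hP
  have hf : (∏ r ∈ S, c r) * P⁻¹ ^ S.card ≤ ∏ r, (complexGaussian (N.σf r)).real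
      (if r ∈ S then {z : ℂ | ‖z‖ ^ 2 * P ≤ 1} else Set.univ) := by
    rw [Finset.prod_mul_pow_card, ← Finset.prod_subset (Finset.subset_univ S)]
    · refine Finset.prod_le_prod (fun r _ => by have := hc r; positivity) fun r hr => ?_
      rw [if_pos hr]
      exact h r P hP
    · intro r _ hr
      rw [if_neg hr, probReal_univ]
  rw [channelLaw, noisyRelays, measureReal_prod_prod, measureReal_def, measureReal_def,
    Measure.pi_pi, Measure.pi_pi, ENNReal.toReal_prod, ENNReal.toReal_prod, mul_right_comm]
  exact mul_le_mul_of_nonneg_right hf (Finset.prod_nonneg fun _ _ => measureReal_nonneg)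

/-! ### Bounded SNR on the bad event -/

variable {P : ℝ}

lemma rho_nonneg (hP : 0 < P) (h : ChannelState R) (r : Fin R) : 0 ≤ N.rho P h r := by
  have := N.p₀_pos
  have := N.p_pos r
  unfold rho
  positivity

/-- Normalization by the received power cancels the gain `|f_r|²`, which leaves a bound free of both
`P` and `h`. -/
lemma norm_sq_mul_rho_le (hP : 0 < P) (h : ChannelState R) (r : Fin R) :
    ‖h.1 r‖ ^ 2 * N.rho P h r ≤ N.p r / N.p₀ := by
  have h0 := N.p₀_pos
  have hr := N.p_pos r
  rw [rho, ← mul_div_assoc, div_le_div_iff₀ (by positivity) h0]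
  nlinarith [mul_pos hr hP]

lemma norm_mul_sqrt_rho_le (hP : 0 < P) (h : ChannelState R) (r : Fin R) :
    ‖h.1 r‖ * Real.sqrt (N.rho P h r) ≤ Real.sqrt (N.p r / N.p₀) := by
  refine Real.le_sqrt_of_sq_le ?_
  rw [mul_pow, Real.sq_sqrt (N.rho_nonneg hP h r)]
  exact N.norm_sq_mul_rho_le hP h r

lemma le_rho (hP : 0 < P) {h : ChannelState R} {r : Fin R} (hr : ‖h.1 r‖ ^ 2 * P ≤ 1) :
    N.p r / (1 + N.p₀) * P ≤ N.rho P h r := by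
  have h0 := N.p₀_pos
  have hp := N.p_pos r
  rw [rho, div_mul_eq_mul_div]
  gcongr
  nlinarith

lemma SNR_le_of_mem_noisyRelays (hP : 0 < P) {S : Finset (Fin R)} {h : ChannelState R}
    (hh : h ∈ noisyRelays P S) {x : BeamVector R} (hx : ∀ r, ‖x r‖ ≤ 1) {r : Fin R}
    (hr : r ∈ S) (hxr : x r ≠ 0) :
    N.SNR P x h ≤ N.p₀ * (∑ s, 2 * Real.sqrt (N.p s / N.p₀)) ^ 2 /
      (‖x r‖ ^ 2 * (N.p r / (1 + N.p₀))) := by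
  have h0 := N.p₀_pos
  have hp := N.p_pos r
  have hx0 : 0 < ‖x r‖ := norm_pos_iff.2 hxr
  have hg : ∀ s, 1 ≤ ‖h.2 s‖ ∧ ‖h.2 s‖ ≤ 2 := fun s => hh.2 s trivial
  have hf : ‖h.1 r‖ ^ 2 * P ≤ 1 := by
    have := hh.1 r trivial
    simpa only [if_pos hr, Set.mem_ofPred_eq] using this
  have hnum : ‖∑ s, x s * h.1 s * h.2 s * ((Real.sqrt (N.rho P h s) : ℝ) : ℂ)‖ ≤
      ∑ s, 2 * Real.sqrt (N.p s / N.p₀) := by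
    refine norm_sum_le_of_le _ fun s _ => ?_
    rw [norm_mul, norm_mul, norm_mul, Complex.norm_real, Real.norm_of_nonneg (Real.sqrt_nonneg _)]
    calc ‖x s‖ * ‖h.1 s‖ * ‖h.2 s‖ * Real.sqrt (N.rho P h s)
        = ‖x s‖ * ‖h.2 s‖ * (‖h.1 s‖ * Real.sqrt (N.rho P h s)) := by ring
      _ ≤ 1 * 2 * Real.sqrt (N.p s / N.p₀) :=
        mul_le_mul (mul_le_mul (hx s) (hg s).2 (norm_nonneg _) zero_le_one)
          (N.norm_mul_sqrt_rho_le hP h s) (by positivity) (by norm_num)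
      _ = _ := by ring
  have hden : ‖x r‖ ^ 2 * (N.p r / (1 + N.p₀)) * P ≤
      1 + ∑ s, ‖x s‖ ^ 2 * ‖h.2 s‖ ^ 2 * N.rho P h s := by
    have hterm : ‖x r‖ ^ 2 * (N.p r / (1 + N.p₀)) * P ≤
        ‖x r‖ ^ 2 * ‖h.2 r‖ ^ 2 * N.rho P h r := by
      rw [mul_assoc, mul_assoc]
      refine mul_le_mul_of_nonneg_left ((N.le_rho hP hf).trans ?_) (by positivity)
      -- Since `|g_r| ≥ 1`, the forwarded noise is not attenuated on its way to the receiver.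
      exact le_mul_of_one_le_left (N.rho_nonneg hP h r) (one_le_pow₀ (hg r).1)
    have hsum := Finset.single_le_sum (f := fun s => ‖x s‖ ^ 2 * ‖h.2 s‖ ^ 2 * N.rho P h s)
      (fun s _ => mul_nonneg (by positivity) (N.rho_nonneg hP h s)) (Finset.mem_univ r)
    linarith
  calc N.SNR P x h ≤ N.p₀ * P * (∑ s, 2 * Real.sqrt (N.p s / N.p₀)) ^ 2 /
        (‖x r‖ ^ 2 * (N.p r / (1 + N.p₀)) * P) := by
        unfold SNR
        gcongr
    _ = _ := by
        rw [mul_right_comm, mul_div_mul_right _ _ hP.ne']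

lemma exists_SNR_le_on_noisyRelays {C : Set (BeamVector R)} (hfin : C.Finite)
    (hpow : ∀ x ∈ C, ∀ r, ‖x r‖ ≤ 1) {S : Finset (Fin R)} (hS : S ∈ relayCovers C) :
    ∃ K : ℝ, ∀ P : ℝ, 0 < P → ∀ h ∈ noisyRelays P S, ∀ x ∈ C, N.SNR P x h ≤ K := by
  have hbound : ∀ x ∈ C, ∃ K : ℝ, ∀ P : ℝ, 0 < P → ∀ h ∈ noisyRelays P S, N.SNR P x h ≤ K := by
    intro x hx
    obtain ⟨r, hr, hxr⟩ := hS x hx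
    exact ⟨_, fun P hP h hh => N.SNR_le_of_mem_noisyRelays hP hh (hpow x hx) hr hxr⟩
  choose! B hB using hbound
  obtain ⟨K, hK⟩ := (hfin.image B).bddAbove
  exact ⟨K, fun P hP h hh x hx => (hB x hx P hP h hh).trans (hK (Set.mem_image_of_mem _ hx))⟩

/-! ### From bounded SNR to the error rate and the diversity -/

lemma measurable_SNR (P : ℝ) (x : BeamVector R) : Measurable (N.SNR P x) := by
  unfold SNR rho
  fun_prop

variable {N}

/-- The quantizer itself may break ties non-measurably, but the SNR it attains is a finite maximum
of measurable functions. -/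
lemma IsOptimalQuantizer.measurable_SNR {C : Set (BeamVector R)} (hfin : C.Finite)
    {q : ChannelState R → BeamVector R} (hq : N.IsOptimalQuantizer P C q) :
    Measurable fun h => N.SNR P (q h) h := by
  have hmem : ∀ h, q h ∈ hfin.toFinset := fun h => hfin.mem_toFinset.2 (hq h).1
  have hne : hfin.toFinset.Nonempty := ⟨_, hmem 0⟩
  have heq : (fun h => N.SNR P (q h) h) = hfin.toFinset.sup' hne (N.SNR P) := by
    funext h
    rw [Finset.sup'_apply]
    exact le_antisymm (Finset.le_sup' (fun x => N.SNR P x h) (hmem h))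
      (Finset.sup'_le _ _ fun x hx => (hq h).2 x (hfin.mem_toFinset.1 hx))
  rw [heq]
  exact Finset.measurable_sup' hne fun x _ => N.measurable_SNR P x

/-- Without integrability the integral in `SER` would be `0` by default, and no positive lower bound
could hold. -/
lemma IsOptimalQuantizer.integrable_gaussianTail {C : Set (BeamVector R)} (hfin : C.Finite)
    {q : ChannelState R → BeamVector R} (hq : N.IsOptimalQuantizer P C q) :
    Integrable (fun h => gaussianTail (Real.sqrt (2 * N.SNR P (q h) h))) N.channelLaw := by
  refine Integrable.of_bound (gaussianTail_antitone.measurable.comp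
    ((hq.measurable_SNR hfin).const_mul 2).sqrt).aestronglyMeasurable 1 (ae_of_all _ fun h => ?_)
  rw [Real.norm_of_nonneg (gaussianTail_pos _).le]
  exact gaussianTail_le_one _

lemma IsOptimalQuantizer.le_SER {C : Set (BeamVector R)} (hfin : C.Finite)
    {q : ChannelState R → BeamVector R} (hq : N.IsOptimalQuantizer P C q)
    {A : Set (ChannelState R)} (hA : MeasurableSet A) {K : ℝ}
    (hK : ∀ h ∈ A, ∀ x ∈ C, N.SNR P x h ≤ K) :
    gaussianTail (Real.sqrt (2 * K)) * N.channelLaw.real A ≤ N.SER P q := by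
  have hint := hq.integrable_gaussianTail hfin
  calc gaussianTail (Real.sqrt (2 * K)) * N.channelLaw.real A
      ≤ ∫ h in A, gaussianTail (Real.sqrt (2 * N.SNR P (q h) h)) ∂N.channelLaw := by
        refine setIntegral_ge_of_const_le_real hA (measure_ne_top _ _) (fun h hh => ?_)
          hint.integrableOn
        refine gaussianTail_antitone (Real.sqrt_le_sqrt ?_)
        linarith [hK h hh _ (hq h).1]
    _ ≤ N.SER P q :=
        setIntegral_le_integral hint (ae_of_all _ fun h => (gaussianTail_pos _).le)

variable (N)

lemma exists_le_SER {C : Set (BeamVector R)} (hfin : C.Finite)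
    (hpow : ∀ x ∈ C, ∀ r, ‖x r‖ ≤ 1) {Q : ℝ → ChannelState R → BeamVector R}
    (hQ : ∀ P : ℝ, 0 < P → N.IsOptimalQuantizer P C (Q P))
    {S : Finset (Fin R)} (hS : S ∈ relayCovers C) :
    ∃ c : ℝ, 0 < c ∧ ∀ P : ℝ, 1 ≤ P → c * P⁻¹ ^ S.card ≤ N.SER P (Q P) := by
  obtain ⟨K, hK⟩ := N.exists_SNR_le_on_noisyRelays hfin hpow hS
  obtain ⟨c, hc, h⟩ := N.exists_le_channelLaw_real_noisyRelays S
  refine ⟨gaussianTail (Real.sqrt (2 * K)) * c, mul_pos (gaussianTail_pos _) hc, fun P hP => ?_⟩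
  have hP0 : 0 < P := one_pos.trans_le hP
  rw [mul_assoc]
  exact (mul_le_mul_of_nonneg_left (h P hP) (gaussianTail_pos _).le).trans
    ((hQ P hP0).le_SER hfin (measurableSet_noisyRelays P S) (hK P hP0))

lemma limsup_diversityRatio_le {Q : ℝ → ChannelState R → BeamVector R} {c : ℝ} (hc : 0 < c)
    {n : ℕ} (h : ∀ P : ℝ, 1 ≤ P → c * P⁻¹ ^ n ≤ N.SER P (Q P)) :
    limsup (N.diversityRatio Q) atTop ≤ (n : EReal) := by
  -- This is the ratio for an error rate of exactly `c * P⁻¹ ^ n`; the constant `c` disappears in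
  -- the limit.
  have hlim : Tendsto (fun P : ℝ => (((n : ℝ) + -Real.log c / Real.log P : ℝ) : EReal)) atTop
      (𝓝 ((n : ℝ) : EReal)) := by
    refine (continuous_coe_real_ereal.tendsto _).comp ?_
    simpa using (Real.tendsto_log_atTop.const_div_atTop (-Real.log c)).const_add (n : ℝ)
  rw [show (n : EReal) = ((n : ℝ) : EReal) from rfl, ← hlim.limsup_eq]
  refine limsup_le_limsup ?_
  filter_upwards [eventually_gt_atTop 1] with P hP
  have hP0 : 0 < P := one_pos.trans hP
  have hlog : 0 < Real.log P := Real.log_pos hP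
  refine EReal.coe_le_coe_iff.2 ?_
  have hle := Real.log_le_log (by positivity) (h P hP.le)
  rw [Real.log_mul hc.ne' (by positivity), Real.log_pow, Real.log_inv] at hle
  rw [div_le_iff₀ hlog, add_mul, div_mul_cancel₀ _ hlog.ne']
  linarith

end RelayNetwork

theorem theorem1 {R : ℕ} (N : RelayNetwork R)
    -- a finite power-independent codebook obeying the relay power constraints
    (C : Set (BeamVector R)) (hfin : C.Finite) (hne : C.Nonempty)
    (hpow : ∀ x ∈ C, ∀ r, ‖x r‖ ≤ 1)
    -- the optimal quantizers of `C`, with any rule for breaking ties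
    (Q : ℝ → ChannelState R → BeamVector R)
    (hQ : ∀ P : ℝ, 0 < P → N.IsOptimalQuantizer P C (Q P)) :
    -- the diversity of `C` is at most the least cardinality of a cover
    -- (an infimum in the extended reals: a minimum as soon as there is a cover)
    (∀ d : EReal, N.HasDiversity Q d → d ≤ ⨅ S ∈ relayCovers C, (S.card : EReal)) ∧
    -- and the bound holds even without existence of the limit
      limsup (N.diversityRatio Q) atTop ≤ ⨅ S ∈ relayCovers C, (S.card : EReal) := by
  have hsup : limsup (N.diversityRatio Q) atTop ≤ ⨅ S ∈ relayCovers C, (S.card : EReal) := by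
    refine le_iInf₂ fun S hS => ?_
    obtain ⟨c, hc, h⟩ := N.exists_le_SER hfin hpow hQ hS
    exact N.limsup_diversityRatio_le hc h
  exact ⟨fun d hd => hd.limsup_eq ▸ hsup, hsup⟩
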